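/- **Setting.** Let $f:\mathbb R^n\to\mathbb R^D$ be a measurable map (the decoder), let the latent codes $z_1,\dots,z_n$ be independent with arbitrary laws $q_1,\dots,q_n$, fix a latent code (generative factor) $z_d$, a Gaussian law $N(\rho,\sigma^2)$, $\sigma>0$, with cumulative function $F$, a batch size $N$, and a real $\alpha_{\max}>0$. *Divergence.* For a graph with edge weights $m$ let $\mathrm{VR}_\alpha(m)$ be its Vietoris–Rips complex at the threshold $\alpha$, and take homology modulo 2. For two point clouds $X,\tilde X$ with the same finite ordered index set and distance matrices $w,\tilde w$, the R-Cross-Barcode$_i(X,\tilde X)$ is the $i$-th persistence barcode of the Vietoris–Rips filtration of the graph on the doubled vertex set with weights $$\begin{pmatrix}0&(w_+)^{\top}\\ w_+&\min(w,\tilde w)\end{pmatrix},$$ where $w_+$ is $w$ with the part below the diagonal replaced by $+\infty$; the class of the single connected component, which never dies, is not recorded. $\mathrm{RTD}_i(X,\tilde X)$ is the half-sum of the total interval lengths of R-Cross-Barcode$_i(X,\tilde X)$ and R-Cross-Barcode$_i(\tilde X,X)$. *TopDis.* The shift along $z_d$ with parameter $C$ replaces $z_d$ by $F^{-1}(F(z_d)+C)$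 and keeps the other codes. For a batch $z=(z^{(1)},\dots,z^{(N)})$ of latent vectors, $\mathrm{TopDis}_i(z,C)$ is $\mathrm{RTD}_i$ between the decoded original and the decoded shifted batch, restricted to those elements for which $F(z^{(j)}_d)+C\in(0,1)$. *Relative living times.* For a batch $z$, the RLT of its decoded point cloud (in homological degree $0$) is the distribution on $\mathbb N$ that gives to $m$ the proportion of thresholds $\alpha\in[0,\alpha_{\max}]$ at which the Vietoris–Rips complex of the cloud has zeroth Betti number $m$. $\mathrm{RLT}(d,k)$, the RLT of the data submanifold conditioned on $z_d=k$, is the mean of this distribution over $N$ independent latent vectors drawn from the conditional law given $z_d=k$ (that is, $z_d=k$ and the other codes are independent with laws $q_i$, $i\ne d$). $W$ is the Wasserstein-1 distance between distributions on $\mathbb N$ with ground distance $|m-m'|$. **Proposition.** Let $\varepsilon\in\mathbb R$. Suppose that $\mathrm{TopDis}_i(z,a)<\varepsilon$ for $i=0,1$, every $0<a\le \frac18$, every real $c$ and every batch $z$ of $N$ latent vectors all of which satisfy $z_d=c$. Then for any two values $k,k'\in\mathbb R$ of $z_d$: 1. for every batch $z$ of $N$ latent vectors with $z_d=k$, if $z'$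 is the batch obtained from $z$ by moving $z_d$ from $k$ to $k'$ (the other codes being kept), the Wasserstein distance between the RLTs of the decoded batches $f(z)$ and $f(z')$ is smaller than $\frac{16}{\alpha_{\max}}\varepsilon$; 2. $\displaystyle W\big(\mathrm{RLT}(d,k),\mathrm{RLT}(d,k')\big)<\frac{16}{\alpha_{\max}}\,\varepsilon .$ -/

import Mathlib

open MeasureTheory ProbabilityTheory
open scoped ENNReal NNReal

noncomputable section

/-! ### Simplicial homology modulo 2, Vietoris-Rips filtrations, barcodes

A complex on the vertex set `V` is a set `K` of finite nonempty subsets of `V`; all chain spaces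
are subspaces of the space of functions `Finset V → ZMod 2`. -/

section Homology

variable {V : Type} [Fintype V] [DecidableEq V]

/-- The boundary operator modulo 2: a simplex goes to the sum of its nonempty facets. -/
def boundary (V : Type) [Fintype V] [DecidableEq V] :
    (Finset V → ZMod 2) →ₗ[ZMod 2] (Finset V → ZMod 2) where
  toFun c := fun t => if t.Nonempty then ∑ v ∈ tᶜ, c (insert v t) else 0
  map_add' c c' := by
    funext t
    by_cases h : t.Nonempty <;> simp [h, Finset.sum_add_distrib]
  map_smul' r c := by
    funext t
    by_cases h : t.Nonempty <;> simp [h, Finset.mul_sum]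

/-- The `k`-chains of `K`: combinations of the `k`-dimensional simplices of `K`. -/
def chains (K : Set (Finset V)) (k : ℕ) : Submodule (ZMod 2) (Finset V → ZMod 2) where
  carrier := {c | ∀ s, c s ≠ 0 → s ∈ K ∧ s.card = k + 1}
  zero_mem' := by
    intro s hs
    exact absurd rfl hs
  add_mem' := by
    intro a b ha hb s hs
    by_cases h : a s = 0
    · refine hb s fun h' => hs ?_
      simp [h, h']
    · exact ha s h
  smul_mem' := by
    intro r a ha s hs
    refine ha s fun h => hs ?_
    simp [h]

/-- The `k`-cycles of `K`. -/
def cycles (K : Set (Finset V)) (k : ℕ) : Submodule (ZMod 2) (Finset V → ZMod 2) :=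
  chains K k ⊓ LinearMap.ker (boundary V)

/-- The `k`-boundaries of `K`. -/
def boundaries (K : Set (Finset V)) (k : ℕ) : Submodule (ZMod 2) (Finset V → ZMod 2) :=
  (chains K (k + 1)).map (boundary V)

/-- The persistent homology group of `K ⊆ L`: the image of `H_k(K) → H_k(L)`, in its usual form
`Z_k(K) / (Z_k(K) ∩ B_k(L))`. For `L = K` it is the homology group `H_k(K)` itself. -/
abbrev PersistentHomology (K L : Set (Finset V)) (k : ℕ) : Type :=
  cycles K k ⧸ (boundaries L k).submoduleOf (cycles K k)

/-- The rank of `H_k(K) → H_k(L)` for `K ⊆ L`. -/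
def persistentBetti (K L : Set (Finset V)) (k : ℕ) : ℕ :=
  Module.finrank (ZMod 2) (PersistentHomology K L k)

/-- The `k`-th Betti number, the dimension of `H_k(K) = ker ∂_k / im ∂_{k+1}`. -/
def betti (K : Set (Finset V)) (k : ℕ) : ℕ := persistentBetti K K k

/-- The Vietoris-Rips complex, at the threshold `α`, of the weighted graph with weights `m`. -/
def vietorisRips (m : V → V → ℝ≥0∞) (α : ℝ≥0∞) : Set (Finset V) :=
  {s | s.Nonempty ∧ ∀ u ∈ s, ∀ v ∈ s, m u v ≤ α}

/-- The Vietoris-Rips complex just before the threshold `α`: the union of the complexes at the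
thresholds below `α`. -/
def vietorisRipsBefore (m : V → V → ℝ≥0∞) (α : ℝ≥0∞) : Set (Finset V) :=
  {s | s.Nonempty ∧ ∀ u ∈ s, ∀ v ∈ s, m u v < α}

/-- The number of independent `k`-dimensional homology classes of the Vietoris-Rips filtration
that are born at `b` and die at `d`. -/
def barMultiplicity (m : V → V → ℝ≥0∞) (k : ℕ) (b d : ℝ≥0∞) : ℤ :=
  ((persistentBetti (vietorisRips m b) (vietorisRipsBefore m d) k : ℤ)
      - persistentBetti (vietorisRips m b) (vietorisRips m d) k)
    - ((persistentBetti (vietorisRipsBefore m b) (vietorisRipsBefore m d) k : ℤ)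
      - persistentBetti (vietorisRipsBefore m b) (vietorisRips m d) k)

/-- The thresholds at which the filtration changes. -/
def criticalValues (m : V → V → ℝ≥0∞) : Finset ℝ≥0∞ :=
  Finset.univ.image fun p : V × V => m p.1 p.2

/-- The `k`-th persistence barcode of a weighted graph, a multiset of pairs (birth, death).
Edges of weight `∞` enter at the threshold `∞`, where the complex is the full simplex, so a class
that outlives all finite thresholds has death time `∞`; only the class of the one connected
component of the full simplex is never killed, and, as usual, it is not recorded. -/
def barcode (m : V → V → ℝ≥0∞) (k : ℕ) : Multiset (ℝ≥0∞ × ℝ≥0∞) :=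
  ∑ p ∈ (criticalValues m ×ˢ criticalValues m).filter (fun p => p.1 < p.2),
    Multiset.replicate (barMultiplicity m k p.1 p.2).toNat p

/-- The relative living times of a weighted graph in degree `k`: the proportion of the thresholds
`α ∈ [0, αmax]` at which the `k`-th Betti number of the Vietoris-Rips complex is `n`. -/
def relativeLivingTimes (αmax : ℝ) (k : ℕ) (m : V → V → ℝ≥0∞) (n : ℕ) : ℝ≥0∞ :=
  volume {α : ℝ | α ∈ Set.Icc 0 αmax ∧ betti (vietorisRips m (ENNReal.ofReal α)) k = n}
    / ENNReal.ofReal αmax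

end Homology

/-! ### Representation topology divergence -/

section RTD

variable {I Y : Type} [Fintype I] [LinearOrder I] [PseudoEMetricSpace Y]

/-- The distance matrix of a point cloud. -/
def distMatrix (X : I → Y) (i j : I) : ℝ≥0∞ := edist (X i) (X j)

/-- The weights `[[0, w₊ᵀ], [w₊, min(w, w')]]` on the doubled vertex set, where `w₊` is `w` with
the part below the diagonal replaced by `∞`. -/
def crossWeights (w w' : I → I → ℝ≥0∞) : I ⊕ I → I ⊕ I → ℝ≥0∞
  | .inl _, .inl _ => 0
  | .inr i, .inl j => if i ≤ j then w i j else ∞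
  | .inl j, .inr i => if i ≤ j then w i j else ∞
  | .inr i, .inr j => min (w i j) (w' i j)

/-- The R-Cross-Barcode of two point clouds with a one-to-one correspondence, in degree `k`. -/
def crossBarcode (k : ℕ) (X X' : I → Y) : Multiset (ℝ≥0∞ × ℝ≥0∞) :=
  barcode (crossWeights (distMatrix X) (distMatrix X')) k

/-- One-sided divergence: the sum of the lengths of the intervals in the R-Cross-Barcode. -/
def RTDOneSided (k : ℕ) (X X' : I → Y) : ℝ≥0∞ :=
  ((crossBarcode k X X').map fun p => p.2 - p.1).sum

/-- The representation topology divergence in degree `k`: the half-sum of the two one-sided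
divergences. -/
def RTD (k : ℕ) (X X' : I → Y) : ℝ≥0∞ :=
  (RTDOneSided k X X' + RTDOneSided k X' X) / 2

end RTD

/-! ### Latent shifts and the TopDis loss -/

/-- The cumulative distribution function of `N(ρ, v)`. -/
def gaussianCDF (ρ : ℝ) (v : ℝ≥0) (x : ℝ) : ℝ := cdf (gaussianReal ρ v) x

/-- The quantile function of `N(ρ, v)`, on `(0, 1)` the inverse of the cumulative function. -/
def gaussianQuantile (ρ : ℝ) (v : ℝ≥0) (u : ℝ) : ℝ := sInf {x | u ≤ gaussianCDF ρ v x}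

/-- The shift `F⁻¹(F(z_d) + C)` of the `d`-th latent code, the other codes being kept. -/
def latentShift {n : ℕ} (ρ : ℝ) (v : ℝ≥0) (d : Fin n) (C : ℝ) (z : Fin n → ℝ) : Fin n → ℝ :=
  Function.update z d (gaussianQuantile ρ v (gaussianCDF ρ v (z d) + C))

open Classical in
/-- The elements of a batch of latents that can be shifted. -/
def validSet {n N : ℕ} (ρ : ℝ) (v : ℝ≥0) (d : Fin n) (C : ℝ) (z : Fin N → Fin n → ℝ) :
    Finset (Fin N) :=
  Finset.univ.filter fun j => gaussianCDF ρ v (z j d) + C ∈ Set.Ioo (0 : ℝ) 1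

/-- The TopDis loss in degree `i` of the batch of latents `z`, for the decoder `f` and the shift
along the `d`-th latent code with parameter `C`. -/
def TopDis {n N : ℕ} {Y : Type} [PseudoEMetricSpace Y] (f : (Fin n → ℝ) → Y) (ρ : ℝ) (v : ℝ≥0)
    (d : Fin n) (i : ℕ) (z : Fin N → Fin n → ℝ) (C : ℝ) : ℝ≥0∞ :=
  RTD i (fun j : validSet ρ v d C z => f (z j))
    (fun j : validSet ρ v d C z => f (latentShift ρ v d C (z j)))

/-! ### Relative living times of the conditioned data submanifolds -/

/-- The Wasserstein (earth mover's) distance between two distributions on `ℕ`, for the ground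
distance `|i - j|`: the least transport cost over all couplings. -/
def wassersteinNat (p q : ℕ → ℝ≥0∞) : ℝ≥0∞ :=
  ⨅ (π : ℕ → ℕ → ℝ≥0∞) (_ : (∀ i, ∑' j, π i j = p i) ∧ (∀ j, ∑' i, π i j = q j)),
    ∑' i, ∑' j, π i j * edist (i : ℝ) (j : ℝ)

/-- The law of the latents conditioned on `z_d = k`, when the latent codes are independent with
laws `q i`. -/
def conditionedLatentLaw {n : ℕ} (q : Fin n → Measure ℝ) (d : Fin n) (k : ℝ) :
    Measure (Fin n → ℝ) :=
  (Measure.pi q).map fun z => Function.update z d k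

/-- The relative living times, in degree zero (numbers of connected components), of a decoded
batch. -/
def sampleRLT {n N : ℕ} {Y : Type} [PseudoEMetricSpace Y] (f : (Fin n → ℝ) → Y) (αmax : ℝ)
    (z : Fin N → Fin n → ℝ) : ℕ → ℝ≥0∞ :=
  relativeLivingTimes αmax 0 (distMatrix fun j => f (z j))

/-- The relative living times of the data submanifold conditioned on `z_d = k`: the mean of the
relative living times of `N` independent samples from it. -/
def submanifoldRLT {n : ℕ} {Y : Type} [PseudoEMetricSpace Y] (f : (Fin n → ℝ) → Y)
    (q : Fin n → Measure ℝ) (N : ℕ) (αmax : ℝ) (d : Fin n) (k : ℝ) (m : ℕ) : ℝ≥0∞ :=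
  ∫⁻ z : Fin N → Fin n → ℝ, sampleRLT f αmax z m
    ∂(Measure.pi fun _ : Fin N => conditionedLatentLaw q d k)

end

/-!
The decoded clouds of two batches are compared through their numbers of connected components as
functions of the threshold.

For two clouds with weights `w`, `w'`, collapsing the upper copy of the doubled graph to a point
gives, up to homotopy, the mapping cone of the inclusion of the Vietoris-Rips complex of `w` into
that of `min (w, w')`. Only one piece of its long exact sequence is needed: the classes of `H₀(w)` that die
in `H₀(min (w, w'))` lift to `H₁` of the doubled graph, so that at each finite threshold
`β₀(w) - β₀(min) ≤ β₁(doubled)` (`betti_zero_le_add_betti_one_crossWeights`). The connecting map is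
explicit on chains (`verticalPart`), and everything else is a comparison of ranks.

The barcode multiplicities are mixed differences of persistent Betti numbers, so the bars alive at
a threshold, counted with multiplicity, telescope to the Betti number
(`betti_eq_sum_barMultiplicity`). Integrating over the thresholds, the area under the curve `β₁` is
at most the total bar length (`lintegral_betti_le_sum_barcode`). Together: the curves `β₀` of two
clouds are at `L¹` distance at most twice their divergence in degree one
(`lintegral_edist_betti_zero_le_RTD`).

Since the Gaussian cumulative function `F` is continuous and strictly increasing, moving a code
from `k` to `k' > k` is a composition of eight shifts with the parameter `(F(k') - F(k)) / 8`, which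
lies in `(0, 1/8]`; the triangle inequality in `L¹` costs the factor `8 * 2 = 16`. Finally, the
relative living times are the law of the number of components at a uniform threshold in
`[0, αmax]`, so using the same threshold, and for the conditioned submanifolds also the same
random batch of the remaining codes, couples the two distributions
(`wassersteinNat_le_lintegral_edist`), at a cost of `1 / αmax` times the `L¹` distance.
-/

/-! ### Total length of a barcode -/

theorem sum_filter_le_sub_filter_lt {α M : Type*} [LinearOrder α] [AddCommGroup M]
    (Φ : Finset α → M) (S : Finset α) :
    ∑ b ∈ S, (Φ (S.filter (· ≤ b)) - Φ (S.filter (· < b))) = Φ S - Φ ∅ := by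
  induction S using Finset.induction_on_max with
  | empty => simp
  | insert a S ha ih =>
    have hnot : a ∉ S := fun h => lt_irrefl a (ha a h)
    have h1 : (insert a S).filter (· ≤ a) = insert a S := by
      refine Finset.filter_true_of_mem fun x hx => ?_
      rcases Finset.mem_insert.1 hx with rfl | hx
      exacts [le_rfl, (ha x hx).le]
    have h2 : (insert a S).filter (· < a) = S := by
      rw [Finset.filter_insert, if_neg (lt_irrefl a)]
      exact Finset.filter_true_of_mem ha
    have h3 : ∑ b ∈ S, (Φ ((insert a S).filter (· ≤ b)) - Φ ((insert a S).filter (· < b)))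
        = Φ S - Φ ∅ := by
      rw [← ih]
      refine Finset.sum_congr rfl fun b hb => ?_
      rw [Finset.filter_insert, Finset.filter_insert, if_neg (ha b hb).not_ge,
        if_neg (ha b hb).not_gt]
    rw [Finset.sum_insert hnot, h1, h2, h3]
    abel

section Barcode

variable {V : Type} [Fintype V] [DecidableEq V]

/-- The complex of the simplices all of whose pairs of vertices have a weight in `T`. Both
Vietoris-Rips complexes at a threshold are of this form, which lets the filtration be indexed by
finite sets of critical values. -/
def weightComplex (m : V → V → ℝ≥0∞) (T : Finset ℝ≥0∞) : Set (Finset V) :=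
  {s | s.Nonempty ∧ ∀ u ∈ s, ∀ v ∈ s, m u v ∈ T}

omit [DecidableEq V] in
theorem mem_criticalValues (m : V → V → ℝ≥0∞) (u v : V) : m u v ∈ criticalValues m :=
  Finset.mem_image.2 ⟨(u, v), Finset.mem_univ _, rfl⟩

omit [DecidableEq V] in
theorem vietorisRips_eq_weightComplex (m : V → V → ℝ≥0∞) (α : ℝ≥0∞) :
    vietorisRips m α = weightComplex m ((criticalValues m).filter (· ≤ α)) := by
  simp [vietorisRips, weightComplex, mem_criticalValues]

omit [DecidableEq V] in
theorem vietorisRipsBefore_eq_weightComplex (m : V → V → ℝ≥0∞) (α : ℝ≥0∞) :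
    vietorisRipsBefore m α = weightComplex m ((criticalValues m).filter (· < α)) := by
  simp [vietorisRipsBefore, weightComplex, mem_criticalValues]

theorem persistentBetti_eq_zero_of_le {K L : Set (Finset V)} {k : ℕ}
    (h : cycles K k ≤ boundaries L k) : persistentBetti K L k = 0 := by
  have : Subsingleton (PersistentHomology K L k) := by
    rw [Submodule.Quotient.subsingleton_iff, Submodule.submoduleOf_eq_top]
    exact h
  exact Module.finrank_zero_of_subsingleton

theorem cycles_weightComplex_empty (m : V → V → ℝ≥0∞) (k : ℕ) :
    cycles (weightComplex m ∅) k = ⊥ := by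
  refine (Submodule.eq_bot_iff _).2 fun c hc => ?_
  funext s
  by_contra hs
  obtain ⟨⟨⟨u, hu⟩, h⟩, -⟩ := hc.1 s hs
  simpa using h u hu u hu

/-- The full simplex has no homology in positive degrees: a cycle is the boundary of the cone
over it, with any vertex as apex. -/
theorem cycles_le_boundaries_of_forall_mem {K L : Set (Finset V)} {k : ℕ} (hk : k ≠ 0)
    (hL : ∀ s : Finset V, s.Nonempty → s ∈ L) : cycles K k ≤ boundaries L k := by
  intro c hc
  rcases isEmpty_or_nonempty V with hV | ⟨⟨a⟩⟩
  · have : c = 0 := by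
      funext s
      by_contra hs
      have := (hc.1 s hs).2
      simp [Finset.eq_empty_of_isEmpty s] at this
    rw [this]
    exact zero_mem _
  refine ⟨fun s => if a ∈ s then c (s.erase a) else 0, fun s hs => ?_, ?_⟩
  · have ha : a ∈ s := by
      by_contra h
      exact hs (if_neg h)
    simp only [ha, if_true] at hs
    refine ⟨hL s ⟨a, ha⟩, ?_⟩
    have := (hc.1 _ hs).2
    rw [Finset.card_erase_of_mem ha] at this
    have := Finset.card_pos.2 ⟨a, ha⟩
    omega
  · funext t
    have hcyc : ∀ t : Finset V, t.Nonempty → ∑ v ∈ tᶜ, c (insert v t) = 0 := by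
      intro t ht
      have := congrFun (LinearMap.mem_ker.1 hc.2) t
      simpa [boundary, ht] using this
    rcases t.eq_empty_or_nonempty with rfl | ht
    · have : c ∅ = 0 := by
        by_contra h
        simpa using (hc.1 _ h).2
      simp [boundary, this]
    simp only [boundary, LinearMap.coe_mk, AddHom.coe_mk, ht, if_true]
    by_cases ha : a ∈ t
    · have h1 : ∀ v ∈ tᶜ, (if a ∈ insert v t then c ((insert v t).erase a) else 0)
          = c (insert v (t.erase a)) := by
        intro v hv
        have hva : a ≠ v := fun h => (Finset.mem_compl.1 hv) (h ▸ ha)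
        rw [if_pos (Finset.mem_insert_of_mem ha), Finset.erase_insert_of_ne hva.symm]
      rw [Finset.sum_congr rfl h1]
      by_cases hta : (t.erase a).Nonempty
      · have h2 := hcyc _ hta
        rw [Finset.compl_erase, Finset.sum_insert (by simpa using ha),
          Finset.insert_erase ha] at h2
        rw [← sub_eq_zero, CharTwo.sub_eq_add, add_comm]
        exact h2
      · have hta' : t = {a} := by
          rw [Finset.not_nonempty_iff_eq_empty, Finset.erase_eq_empty_iff] at hta
          exact hta.resolve_left ht.ne_empty
        have h0 : ∀ v, c {v} = 0 := by
          intro v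
          by_contra h
          have := (hc.1 _ h).2
          simp at this
          omega
        subst hta'
        simp [h0]
    · rw [Finset.sum_eq_single_of_mem a (by simpa using ha)]
      · simp [Finset.erase_insert ha]
      · intro v _ hva
        rw [if_neg]
        simp [ha, hva.symm]

/-- The structure of the barcode, in the form needed here: the Betti number at `α` counts, with
signed multiplicities, the bars alive at `α`. The multiplicity is a mixed difference of the
persistent Betti numbers, so both sums telescope. -/
theorem betti_eq_sum_barMultiplicity (m : V → V → ℝ≥0∞) {k : ℕ} (hk : k ≠ 0) (α : ℝ≥0∞) :
    (betti (vietorisRips m α) k : ℤ) =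
      ∑ p ∈ (criticalValues m ×ˢ criticalValues m).filter (fun p => p.1 ≤ α ∧ α < p.2),
        barMultiplicity m k p.1 p.2 := by
  set S := criticalValues m with hS
  set T := S.filter (· ≤ α) with hT
  let Ψ : Finset ℝ≥0∞ → Finset ℝ≥0∞ → ℤ := fun P Q =>
    persistentBetti (weightComplex m P) (weightComplex m Q) k
  have hmult : ∀ b d, barMultiplicity m k b d =
      (Ψ (S.filter (· < b)) (S.filter (· ≤ d)) - Ψ (S.filter (· < b)) (S.filter (· < d)))
      - (Ψ (S.filter (· ≤ b)) (S.filter (· ≤ d)) - Ψ (S.filter (· ≤ b)) (S.filter (· < d))) := by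
    intro b d
    simp only [barMultiplicity, vietorisRips_eq_weightComplex,
      vietorisRipsBefore_eq_weightComplex, Ψ]
    ring
  have hle : ∀ b, b ≤ α → S.filter (· ≤ b) = T.filter (· ≤ b) := by
    intro b hb
    rw [hT, Finset.filter_filter]
    exact Finset.filter_congr fun x _ => ⟨fun h => ⟨h.trans hb, h⟩, And.right⟩
  have hlt : ∀ b, b ≤ α → S.filter (· < b) = T.filter (· < b) := by
    intro b hb
    rw [hT, Finset.filter_filter]
    exact Finset.filter_congr fun x _ => ⟨fun h => ⟨h.le.trans hb, h⟩, And.right⟩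
  have hdeath : ∀ Φ : Finset ℝ≥0∞ → ℤ,
      ∑ d ∈ S.filter (α < ·), (Φ (S.filter (· ≤ d)) - Φ (S.filter (· < d))) = Φ S - Φ T := by
    intro Φ
    have h1 := sum_filter_le_sub_filter_lt Φ S
    have h2 := sum_filter_le_sub_filter_lt Φ T
    have h3 : ∑ b ∈ T, (Φ (T.filter (· ≤ b)) - Φ (T.filter (· < b)))
        = ∑ b ∈ T, (Φ (S.filter (· ≤ b)) - Φ (S.filter (· < b))) :=
      Finset.sum_congr rfl fun b hb => by
        rw [hle b (Finset.mem_filter.1 hb).2, hlt b (Finset.mem_filter.1 hb).2]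
    have h4 := Finset.sum_filter_add_sum_filter_not S (· ≤ α)
      (fun b => Φ (S.filter (· ≤ b)) - Φ (S.filter (· < b)))
    simp only [not_le] at h4
    rw [h3] at h2
    linarith
  have hprod : (S ×ˢ S).filter (fun p => p.1 ≤ α ∧ α < p.2) = T ×ˢ S.filter (α < ·) := by
    rw [hT, ← Finset.filter_product]
  have hempty : ∀ Q, Ψ ∅ Q = 0 := fun Q => by
    simp only [Ψ, Nat.cast_eq_zero]
    exact persistentBetti_eq_zero_of_le (by simp [cycles_weightComplex_empty])
  have hfull : Ψ T S = 0 := by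
    simp only [Ψ, Nat.cast_eq_zero]
    exact persistentBetti_eq_zero_of_le (cycles_le_boundaries_of_forall_mem hk
      fun s hs => ⟨hs, fun u _ v _ => mem_criticalValues m u v⟩)
  rw [hprod, Finset.sum_product]
  simp only [hmult, Finset.sum_sub_distrib (G := ℤ) (s := S.filter (α < ·))
    (fun d => Ψ _ (S.filter (· ≤ d)) - Ψ _ (S.filter (· < d))), hdeath]
  have hbirth := sum_filter_le_sub_filter_lt (fun P => Ψ P T - Ψ P S) T
  have hTT : (betti (vietorisRips m α) k : ℤ) = Ψ T T := by
    simp only [betti, vietorisRips_eq_weightComplex, Ψ, ← hS, ← hT]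
  rw [hTT]
  simp only [hempty, hfull, sub_zero] at hbirth
  rw [← hbirth]
  refine Finset.sum_congr rfl fun b hb => ?_
  rw [hle b (Finset.mem_filter.1 hb).2, hlt b (Finset.mem_filter.1 hb).2]
  ring

/-- The Betti numbers, integrated over the finite thresholds, are at most the total length of the
barcode. -/
theorem lintegral_betti_le_sum_barcode (m : V → V → ℝ≥0∞) {k : ℕ} (hk : k ≠ 0) :
    ∫⁻ α in Set.Ici (0 : ℝ), (betti (vietorisRips m (ENNReal.ofReal α)) k : ℝ≥0∞)
      ≤ ((barcode m k).map fun p => p.2 - p.1).sum := by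
  set P := (criticalValues m ×ˢ criticalValues m).filter (fun p => p.1 < p.2) with hP
  let A : ℝ≥0∞ × ℝ≥0∞ → Set ℝ := fun p => {α | p.1 ≤ ENNReal.ofReal α ∧ ENNReal.ofReal α < p.2}
  have hA : ∀ p, MeasurableSet (A p) := fun p =>
    (measurableSet_le measurable_const ENNReal.measurable_ofReal).inter
      (measurableSet_lt ENNReal.measurable_ofReal measurable_const)
  have hvol : ∀ p, volume.restrict (Set.Ici (0 : ℝ)) (A p) ≤ p.2 - p.1 := by
    rintro ⟨b, d⟩
    rw [Measure.restrict_apply (hA _)]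
    induction b with
    | top => simp [A]
    | coe b =>
      induction d with
      | top => simp
      | coe d =>
        refine (measure_mono (t := Set.Ico (b : ℝ) d) ?_).trans ?_
        · rintro α ⟨⟨h1, h2⟩, h3 : (0 : ℝ) ≤ α⟩
          lift α to ℝ≥0 using h3
          simp only [ENNReal.ofReal_coe_nnreal, ENNReal.coe_le_coe, ENNReal.coe_lt_coe] at h1 h2
          exact ⟨by exact_mod_cast h1, by exact_mod_cast h2⟩
        · rw [Real.volume_Ico, ENNReal.ofReal_sub _ b.coe_nonneg, ENNReal.ofReal_coe_nnreal,
            ENNReal.ofReal_coe_nnreal]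
  have hpoint : ∀ α : ℝ, (betti (vietorisRips m (ENNReal.ofReal α)) k : ℝ≥0∞)
      ≤ ∑ p ∈ P, ((barMultiplicity m k p.1 p.2).toNat : ℝ≥0∞) * (A p).indicator 1 α := by
    intro α
    have h1 : betti (vietorisRips m (ENNReal.ofReal α)) k ≤
        ∑ p ∈ P.filter (fun p => α ∈ A p), (barMultiplicity m k p.1 p.2).toNat := by
      have hPA : (criticalValues m ×ˢ criticalValues m).filter
          (fun p => p.1 ≤ ENNReal.ofReal α ∧ ENNReal.ofReal α < p.2)
          = P.filter (fun p => α ∈ A p) := by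
        rw [hP, Finset.filter_filter]
        exact Finset.filter_congr fun p _ => ⟨fun h => ⟨h.1.trans_lt h.2, h⟩, And.right⟩
      have h2 := betti_eq_sum_barMultiplicity m hk (ENNReal.ofReal α)
      rw [hPA] at h2
      zify
      rw [h2]
      exact Finset.sum_le_sum fun p _ => Int.self_le_toNat _
    refine (Nat.cast_le.2 h1).trans ?_
    rw [Nat.cast_sum, Finset.sum_filter]
    refine Finset.sum_le_sum fun p _ => ?_
    by_cases h : α ∈ A p <;> simp [h]
  calc _ ≤ ∫⁻ α in Set.Ici (0 : ℝ),
        ∑ p ∈ P, ((barMultiplicity m k p.1 p.2).toNat : ℝ≥0∞) * (A p).indicator 1 α :=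
        lintegral_mono hpoint
    _ = ∑ p ∈ P, ((barMultiplicity m k p.1 p.2).toNat : ℝ≥0∞) *
        volume.restrict (Set.Ici (0 : ℝ)) (A p) := by
        rw [lintegral_finsetSum P fun p _ => (measurable_one.indicator (hA p)).const_mul _]
        refine Finset.sum_congr rfl fun p _ => ?_
        rw [lintegral_const_mul _ (measurable_one.indicator (hA p)),
          lintegral_indicator_one (hA p)]
    _ ≤ ∑ p ∈ P, ((barMultiplicity m k p.1 p.2).toNat : ℝ≥0∞) * (p.2 - p.1) :=
        Finset.sum_le_sum fun p _ => by gcongr; exact hvol p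
    _ = _ := by
        have hsum := map_sum ((Multiset.sumAddMonoidHom (M := ℝ≥0∞)).comp
          (Multiset.mapAddMonoidHom fun p : ℝ≥0∞ × ℝ≥0∞ => p.2 - p.1))
          (fun p => Multiset.replicate (barMultiplicity m k p.1 p.2).toNat p) P
        simp only [AddMonoidHom.comp_apply, Multiset.coe_sumAddMonoidHom,
          Multiset.coe_mapAddMonoidHom, Multiset.map_replicate, Multiset.sum_replicate,
          nsmul_eq_mul] at hsum
        exact hsum.symm

end Barcode

/-! ### Betti numbers as ranks of chain spaces -/

section Rank

variable {V : Type} [Fintype V] [DecidableEq V]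

theorem persistentBetti_add_finrank (K L : Set (Finset V)) (k : ℕ) :
    persistentBetti K L k +
      Module.finrank (ZMod 2) (cycles K k ⊓ boundaries L k : Submodule (ZMod 2) _)
      = Module.finrank (ZMod 2) (cycles K k) := by
  rw [persistentBetti, ← Submodule.finrank_quotient_add_finrank
    ((boundaries L k).submoduleOf (cycles K k))]
  congr 1
  rw [← Submodule.finrank_map_subtype_eq, Submodule.submoduleOf, Submodule.map_comap_subtype]

theorem boundary_single (s : Finset V) (hs : 2 ≤ s.card) :
    boundary V (Pi.single s 1) = ∑ v ∈ s, Pi.single (s.erase v) 1 := by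
  funext t
  rw [Finset.sum_apply]
  rcases t.eq_empty_or_nonempty with rfl | ht
  · have h0 : ∀ v ∈ s, (Pi.single (s.erase v) 1 : Finset V → ZMod 2) ∅ = 0 := by
      intro v hv
      refine Pi.single_eq_of_ne (fun h => ?_) _
      have := Finset.card_erase_of_mem hv
      rw [← h, Finset.card_empty] at this
      omega
    rw [Finset.sum_eq_zero h0]
    simp [boundary]
  · simp only [boundary, LinearMap.coe_mk, AddHom.coe_mk, ht, if_true, Pi.single_apply]
    rw [← Finset.sum_filter, ← Finset.sum_filter]
    refine Finset.sum_congr ?_ fun _ _ => rfl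
    ext v
    simp only [Finset.mem_filter, Finset.mem_compl]
    constructor
    · rintro ⟨hv, rfl⟩
      exact ⟨Finset.mem_insert_self _ _, (Finset.erase_insert hv).symm⟩
    · rintro ⟨hv, rfl⟩
      exact ⟨Finset.notMem_erase _ _, Finset.insert_erase hv⟩

theorem boundary_single_pair {a b : V} (h : a ≠ b) :
    boundary V (Pi.single {a, b} 1) = Pi.single {a} 1 + Pi.single {b} 1 := by
  rw [boundary_single _ (Finset.card_pair h).ge, Finset.sum_pair h, Finset.erase_insert (by simpa),
    Finset.pair_comm, Finset.erase_insert (by simpa using h.symm), add_comm]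

theorem boundary_single_triple {a b c : V} (hab : a ≠ b) (hac : a ≠ c) (hbc : b ≠ c) :
    boundary V (Pi.single {a, b, c} 1)
      = Pi.single {b, c} 1 + Pi.single {a, c} 1 + Pi.single {a, b} 1 := by
  have h1 : ({a, b, c} : Finset V).erase a = {b, c} := by ext; grind
  have h2 : ({a, b, c} : Finset V).erase b = {a, c} := by ext; grind
  have h3 : ({a, b, c} : Finset V).erase c = {a, b} := by ext; grind
  rw [boundary_single _ (by rw [Finset.card_eq_three.2 ⟨a, b, c, hab, hac, hbc, rfl⟩]; norm_num),
    Finset.sum_insert (by simp [hab, hac]), Finset.sum_pair hbc, h1, h2, h3, add_assoc]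

omit [Fintype V] in
theorem single_mem_chains {K : Set (Finset V)} {k : ℕ} {s : Finset V} (hs : s ∈ K)
    (hk : s.card = k + 1) : Pi.single s 1 ∈ chains K k := by
  intro t ht
  obtain rfl : t = s := by
    by_contra h
    exact ht (Pi.single_eq_of_ne h _)
  exact ⟨hs, hk⟩

theorem map_mem_of_forall_single_mem {K : Set (Finset V)} {k : ℕ} {M : Type*} [AddCommGroup M]
    [Module (ZMod 2) M] (T : (Finset V → ZMod 2) →ₗ[ZMod 2] M) (P : Submodule (ZMod 2) M)
    (h : ∀ s ∈ K, s.card = k + 1 → T (Pi.single s 1) ∈ P) {c : Finset V → ZMod 2}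
    (hc : c ∈ chains K k) : T c ∈ P := by
  rw [LinearMap.pi_apply_eq_sum_univ T c]
  refine Submodule.sum_mem _ fun s _ => ?_
  by_cases hs : c s = 0
  · simp [hs]
  · refine P.smul_mem _ ?_
    convert h s (hc s hs).1 (hc s hs).2 using 2
    funext t
    simp [Pi.single_apply, eq_comm]

end Rank

section Reindex

variable {V W : Type} [Fintype V] [DecidableEq V] [Fintype W] [DecidableEq W]

/-- Betti numbers of Vietoris-Rips complexes do not depend on the names of the vertices. -/
theorem betti_vietorisRips_comp_equiv (e : V ≃ W) (m : W → W → ℝ≥0∞) (α : ℝ≥0∞) (k : ℕ) :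
    betti (vietorisRips (fun a b => m (e a) (e b)) α) k = betti (vietorisRips m α) k := by
  let E : (Finset W → ZMod 2) ≃ₗ[ZMod 2] (Finset V → ZMod 2) :=
    LinearEquiv.funCongrLeft (ZMod 2) (ZMod 2) e.finsetCongr
  have hE : ∀ c t, E c t = c (t.map e.toEmbedding) := fun c t => rfl
  have hsurj : ∀ s : Finset W, ∃ t : Finset V, s = t.map e.toEmbedding := fun s =>
    ⟨s.map e.symm.toEmbedding, by ext; simp⟩
  have hK : ∀ t : Finset V, t.map e.toEmbedding ∈ vietorisRips m α ↔
      t ∈ vietorisRips (fun a b => m (e a) (e b)) α := fun t => by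
    simp only [vietorisRips, Set.mem_ofPred_eq, Finset.map_nonempty, Finset.forall_mem_map,
      Equiv.coe_toEmbedding]
  have hb : ∀ c, boundary V (E c) = E (boundary W c) := by
    intro c
    funext t
    rw [hE]
    simp only [boundary, LinearMap.coe_mk, AddHom.coe_mk, Finset.map_nonempty, hE]
    congr 1
    refine Finset.sum_equiv e (fun v => by simp) fun v _ => ?_
    rw [Finset.map_insert]
    rfl
  have hchains : ∀ k, (chains (vietorisRips m α) k).map E.toLinearMap =
      chains (vietorisRips (fun a b => m (e a) (e b)) α) k := by
    intro k
    ext c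
    rw [Submodule.mem_map_equiv]
    obtain ⟨c, rfl⟩ := E.surjective c
    rw [E.symm_apply_apply]
    constructor
    · intro hc t ht
      have := hc (t.map e.toEmbedding) ht
      rwa [hK, Finset.card_map] at this
    · intro hc s hs
      obtain ⟨t, rfl⟩ := hsurj s
      rw [hK, Finset.card_map]
      exact hc t hs
  have hcycles : (cycles (vietorisRips m α) k).map E.toLinearMap =
      cycles (vietorisRips (fun a b => m (e a) (e b)) α) k := by
    rw [cycles, Submodule.map_inf _ E.injective, hchains, cycles]
    congr 1
    ext c
    rw [Submodule.mem_map_equiv]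
    obtain ⟨c, rfl⟩ := E.surjective c
    rw [E.symm_apply_apply, LinearMap.mem_ker, LinearMap.mem_ker, hb, E.map_eq_zero_iff]
  have hboundaries : (boundaries (vietorisRips m α) k).map E.toLinearMap =
      boundaries (vietorisRips (fun a b => m (e a) (e b)) α) k := by
    rw [boundaries, boundaries, ← hchains, ← Submodule.map_comp, ← Submodule.map_comp]
    congr 1
    exact LinearMap.ext fun c => (hb c).symm
  have h1 := persistentBetti_add_finrank (vietorisRips m α) (vietorisRips m α) k
  have h2 := persistentBetti_add_finrank (vietorisRips (fun a b => m (e a) (e b)) α)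
    (vietorisRips (fun a b => m (e a) (e b)) α) k
  rw [← hcycles, ← hboundaries, ← Submodule.map_inf _ E.injective] at h2
  erw [LinearEquiv.finrank_map_eq, LinearEquiv.finrank_map_eq] at h2
  rw [betti, betti]
  omega

end Reindex

/-! ### Components and first homology of the doubled graph -/

section Components

variable {I : Type} [Fintype I] [DecidableEq I]

theorem mem_cycles_zero_iff {w : I → I → ℝ≥0∞} (hdiag : ∀ i, w i i = 0) (α : ℝ≥0∞)
    (c : Finset I → ZMod 2) :
    c ∈ cycles (vietorisRips w α) 0 ↔ ∀ s, c s ≠ 0 → s.card = 1 := by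
  constructor
  · exact fun hc s hs => (hc.1 s hs).2
  · intro hc
    refine ⟨fun s hs => ⟨?_, hc s hs⟩, ?_⟩
    · obtain ⟨i, rfl⟩ := Finset.card_eq_one.1 (hc s hs)
      simp [vietorisRips, hdiag]
    · refine LinearMap.mem_ker.2 ?_
      funext t
      by_cases ht : t.Nonempty
      · simp only [boundary, LinearMap.coe_mk, AddHom.coe_mk, ht, if_true, Pi.zero_apply]
        refine Finset.sum_eq_zero fun v hv => ?_
        by_contra h
        have := hc _ h
        rw [Finset.card_insert_of_notMem (Finset.mem_compl.1 hv)] at this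
        have := ht.card_pos
        omega
      · simp [boundary, ht]

theorem boundaries_zero_le_cycles {w : I → I → ℝ≥0∞} (hdiag : ∀ i, w i i = 0) (α : ℝ≥0∞) :
    boundaries (vietorisRips w α) 0 ≤ cycles (vietorisRips w α) 0 := by
  rintro _ ⟨c, hc, rfl⟩
  refine map_mem_of_forall_single_mem (boundary I) _ (fun s _ hs => ?_) hc
  obtain ⟨a, b, hab, rfl⟩ := Finset.card_eq_two.1 hs
  rw [boundary_single_pair hab]
  refine Submodule.add_mem _ ?_ ?_ <;>
  · rw [mem_cycles_zero_iff hdiag]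
    intro t ht
    by_contra h
    refine ht (Pi.single_eq_of_ne ?_ _)
    rintro rfl
    simp at h

theorem betti_zero_add_finrank {w : I → I → ℝ≥0∞} (hdiag : ∀ i, w i i = 0) (α : ℝ≥0∞) :
    betti (vietorisRips w α) 0 + Module.finrank (ZMod 2) (boundaries (vietorisRips w α) 0)
      = Module.finrank (ZMod 2) (cycles (vietorisRips w α) 0) := by
  rw [← persistentBetti_add_finrank (vietorisRips w α) (vietorisRips w α) 0,
    inf_eq_right.2 (boundaries_zero_le_cycles hdiag α), betti]

theorem cycles_zero_eq {w w' : I → I → ℝ≥0∞} (hdiag : ∀ i, w i i = 0) (hdiag' : ∀ i, w' i i = 0)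
    (α : ℝ≥0∞) : cycles (vietorisRips w α) 0 = cycles (vietorisRips w' α) 0 := by
  ext c
  rw [mem_cycles_zero_iff hdiag, mem_cycles_zero_iff hdiag']

theorem betti_zero_anti {w w' : I → I → ℝ≥0∞} (hdiag : ∀ i, w i i = 0)
    (hdiag' : ∀ i, w' i i = 0) (h : ∀ i j, w i j ≤ w' i j) (α : ℝ≥0∞) :
    betti (vietorisRips w α) 0 ≤ betti (vietorisRips w' α) 0 := by
  have h1 := betti_zero_add_finrank hdiag α
  have h2 := betti_zero_add_finrank hdiag' α
  rw [cycles_zero_eq hdiag hdiag' α] at h1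
  have hsub : boundaries (vietorisRips w' α) 0 ≤ boundaries (vietorisRips w α) 0 :=
    Submodule.map_mono fun c hc s hs =>
      ⟨⟨(hc s hs).1.1, fun u hu v hv => (h u v).trans ((hc s hs).1.2 u hu v hv)⟩, (hc s hs).2⟩
  have := Submodule.finrank_mono hsub
  omega

theorem single_add_single_mem_boundaries {w : I → I → ℝ≥0∞} (hdiag : ∀ i, w i i = 0)
    (hsymm : ∀ i j, w i j = w j i) {α : ℝ≥0∞} {i j : I} (h : w i j ≤ α) :
    Pi.single {i} 1 + Pi.single {j} 1 ∈ boundaries (vietorisRips w α) 0 := by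
  by_cases hij : i = j
  · rw [hij, CharTwo.add_self_eq_zero]
    exact zero_mem _
  · refine ⟨Pi.single {i, j} 1, single_mem_chains ?_ (Finset.card_pair hij),
      boundary_single_pair hij⟩
    simp [vietorisRips, hdiag, h, hsymm j i]

/-- The connecting homomorphism of the doubled graph at the level of chains: a vertical edge
`{inl j, inr i}`, from the upper copy `inl` to the lower copy `inr`, goes to the vertex `i`, all
other simplices go to zero. -/
noncomputable def verticalPart (I : Type) [Fintype I] [DecidableEq I] :
    (Finset (I ⊕ I) → ZMod 2) →ₗ[ZMod 2] (Finset I → ZMod 2) where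
  toFun c := fun s =>
    if s.card = 1 then ∑ j, c (insert (Sum.inl j) (s.map Function.Embedding.inr)) else 0
  map_add' c c' := by
    funext s
    by_cases h : s.card = 1 <;> simp [h, Finset.sum_add_distrib]
  map_smul' r c := by
    funext s
    by_cases h : s.card = 1 <;> simp [h, Finset.mul_sum]

theorem verticalPart_single (e : Finset (I ⊕ I)) (s : Finset I) :
    verticalPart I (Pi.single e 1) s =
      if s.card = 1 then ∑ j, if insert (Sum.inl j) (s.map Function.Embedding.inr) = e then 1 else 0
      else 0 := by
  simp [verticalPart, Pi.single_apply]

omit [Fintype I] in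
theorem pair_inl_inr_eq_iff {a b : I ⊕ I} {i j : I} :
    ({Sum.inl j, Sum.inr i} : Finset (I ⊕ I)) = {a, b} ↔
      (a = Sum.inl j ∧ b = Sum.inr i) ∨ (a = Sum.inr i ∧ b = Sum.inl j) := by
  constructor
  · intro h
    have h1 : Sum.inl j ∈ ({a, b} : Finset (I ⊕ I)) := by simp [← h]
    have h2 : Sum.inr i ∈ ({a, b} : Finset (I ⊕ I)) := by simp [← h]
    simp only [Finset.mem_insert, Finset.mem_singleton] at h1 h2
    rcases h1 with rfl | rfl <;> rcases h2 with h2 | h2 <;> simp_all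
  · rintro (⟨rfl, rfl⟩ | ⟨rfl, rfl⟩)
    · rfl
    · exact Finset.pair_comm _ _

theorem verticalPart_single_inl_inl (j j' : I) :
    verticalPart I (Pi.single {Sum.inl j, Sum.inl j'} 1) = 0 := by
  funext s
  rw [verticalPart_single, Pi.zero_apply, ite_eq_right_iff]
  intro hs
  obtain ⟨i, rfl⟩ := Finset.card_eq_one.1 hs
  simp [pair_inl_inr_eq_iff]

theorem verticalPart_single_inr_inr (i i' : I) :
    verticalPart I (Pi.single {Sum.inr i, Sum.inr i'} 1) = 0 := by
  funext s
  rw [verticalPart_single, Pi.zero_apply, ite_eq_right_iff]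
  intro hs
  obtain ⟨i, rfl⟩ := Finset.card_eq_one.1 hs
  simp [pair_inl_inr_eq_iff]

theorem verticalPart_single_inl_inr (j i : I) :
    verticalPart I (Pi.single {Sum.inl j, Sum.inr i} 1) = Pi.single {i} 1 := by
  funext s
  rw [verticalPart_single]
  by_cases hs : s.card = 1
  · obtain ⟨i', rfl⟩ := Finset.card_eq_one.1 hs
    by_cases h : i' = i
    · simp [pair_inl_inr_eq_iff, h, Finset.sum_ite_eq]
    · simp [pair_inl_inr_eq_iff, h, Ne.symm h]
  · rw [if_neg hs, Pi.single_eq_of_ne]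
    rintro rfl
    exact hs rfl

theorem verticalPart_single_inr_inl (i j : I) :
    verticalPart I (Pi.single {Sum.inr i, Sum.inl j} 1) = Pi.single {i} 1 := by
  rw [Finset.pair_comm, verticalPart_single_inl_inr]

end Components

section Cross

variable {I : Type} [Fintype I] [LinearOrder I]

omit [Fintype I] in
/-- At the threshold `∞` this fails: there the missing vertical edges are present as well. -/
theorem le_of_crossWeights_inl_inr_le {w w' : I → I → ℝ≥0∞} {α : ℝ≥0∞} (hα : α ≠ ∞) {i j : I}
    (h : crossWeights w w' (Sum.inl j) (Sum.inr i) ≤ α) : w i j ≤ α := by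
  by_cases hij : i ≤ j
  · simpa [crossWeights, hij] using h
  · simp [crossWeights, hij, hα] at h

/-- The vertical edges of a triangle of the doubled graph contribute a boundary in the original
graph: two vertical edges over the same lower vertex cancel, and lower vertices `i`, `i'` joined
to the same upper vertex `j` are both adjacent to `j` in the original graph. -/
theorem verticalPart_mem_boundaries {w w' : I → I → ℝ≥0∞} (hdiag : ∀ i, w i i = 0)
    (hsymm : ∀ i j, w i j = w j i) {α : ℝ≥0∞} (hα : α ≠ ∞) {c : Finset (I ⊕ I) → ZMod 2}
    (hc : c ∈ boundaries (vietorisRips (crossWeights w w') α) 1) :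
    verticalPart I c ∈ boundaries (vietorisRips w α) 0 := by
  obtain ⟨t, ht, rfl⟩ := hc
  refine map_mem_of_forall_single_mem (verticalPart I ∘ₗ boundary (I ⊕ I)) _ (fun s hs hcard => ?_)
    ht
  obtain ⟨a, b, c, hab, hac, hbc, rfl⟩ := Finset.card_eq_three.1 hcard
  have hfork : ∀ i i' j : I, Sum.inl j ∈ ({a, b, c} : Finset (I ⊕ I)) →
      Sum.inr i ∈ ({a, b, c} : Finset (I ⊕ I)) → Sum.inr i' ∈ ({a, b, c} : Finset (I ⊕ I)) →
      Pi.single {i} 1 + Pi.single {i'} 1 ∈ boundaries (vietorisRips w α) 0 := by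
    intro i i' j hj hi hi'
    have h1 := single_add_single_mem_boundaries hdiag hsymm
      (le_of_crossWeights_inl_inr_le hα (hs.2 _ hj _ hi))
    have h2 := single_add_single_mem_boundaries hdiag hsymm
      (le_of_crossWeights_inl_inr_le hα (hs.2 _ hj _ hi'))
    have h3 := Submodule.add_mem _ h1 h2
    rwa [add_add_add_comm, CharTwo.add_self_eq_zero, add_zero] at h3
  rw [LinearMap.comp_apply, boundary_single_triple hab hac hbc, map_add, map_add]
  -- Only the triangles with one upper and two lower vertices survive the simplification.
  rcases a with a | a <;> rcases b with b | b <;> rcases c with c | c <;>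
    simp only [verticalPart_single_inl_inl, verticalPart_single_inl_inr,
      verticalPart_single_inr_inl, verticalPart_single_inr_inr, add_zero, zero_add,
      CharTwo.add_self_eq_zero, zero_mem]
  · exact hfork c b a (by simp) (by simp) (by simp)
  · exact hfork c a b (by simp) (by simp) (by simp)
  · exact hfork b a c (by simp) (by simp) (by simp)

/-- An edge `{i, i'}` of the lower copy closes up, through the vertical edges over `i` and `i'`
and the upper edge `{i, i'}`, to a cycle of the doubled graph. -/
theorem boundaries_le_map_verticalPart {w w' : I → I → ℝ≥0∞} (hdiag : ∀ i, w i i = 0)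
    (hdiag' : ∀ i, w' i i = 0) (α : ℝ≥0∞) :
    boundaries (vietorisRips (fun i j => min (w i j) (w' i j)) α) 0 ≤
      (cycles (vietorisRips (crossWeights w w') α) 1).map (verticalPart I) := by
  rintro _ ⟨c, hc, rfl⟩
  refine map_mem_of_forall_single_mem (boundary I) _ (fun s hs hcard => ?_) hc
  obtain ⟨i, i', hne, rfl⟩ := Finset.card_eq_two.1 hcard
  have h1 := hs.2 i (by simp) i' (by simp)
  have h2 := hs.2 i' (by simp) i (by simp)
  refine ⟨Pi.single {Sum.inr i, Sum.inr i'} 1 + Pi.single {Sum.inr i', Sum.inl i'} 1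
    + Pi.single {Sum.inl i', Sum.inl i} 1 + Pi.single {Sum.inl i, Sum.inr i} 1, ⟨?_, ?_⟩, ?_⟩
  · refine Submodule.add_mem _ (Submodule.add_mem _ (Submodule.add_mem _ ?_ ?_) ?_) ?_
    · refine single_mem_chains ?_ (Finset.card_pair (by simpa using hne))
      simp only [vietorisRips, crossWeights]
      simp_all
    · refine single_mem_chains ?_ (Finset.card_pair (by simp))
      simp [vietorisRips, crossWeights, hdiag, hdiag']
    · refine single_mem_chains ?_ (Finset.card_pair (by simpa using hne.symm))
      simp [vietorisRips, crossWeights]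
    · refine single_mem_chains ?_ (Finset.card_pair (by simp))
      simp [vietorisRips, crossWeights, hdiag, hdiag']
  · refine LinearMap.mem_ker.2 ?_
    rw [map_add, map_add, map_add, boundary_single_pair (by simpa using hne),
      boundary_single_pair (by simp), boundary_single_pair (by simpa using hne.symm),
      boundary_single_pair (by simp)]
    funext t
    simp only [Pi.add_apply, Pi.zero_apply]
    generalize (Pi.single {Sum.inr i} 1 : Finset (I ⊕ I) → ZMod 2) t = x
    generalize (Pi.single {Sum.inr i'} 1 : Finset (I ⊕ I) → ZMod 2) t = y
    generalize (Pi.single {Sum.inl i} 1 : Finset (I ⊕ I) → ZMod 2) t = z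
    generalize (Pi.single {Sum.inl i'} 1 : Finset (I ⊕ I) → ZMod 2) t = u
    linear_combination (x + y + z + u) * (CharTwo.two_eq_zero : (2 : ZMod 2) = 0)
  · rw [map_add, map_add, map_add, verticalPart_single_inr_inr, verticalPart_single_inr_inl,
      verticalPart_single_inl_inl, verticalPart_single_inl_inr, boundary_single_pair hne,
      zero_add, add_zero, add_comm]

/-- Components of the original graph that merge in the graph of the pointwise minima are
witnessed by independent one-dimensional classes of the doubled graph. This is the part
`H₁(doubled) → H₀(w) → H₀(min (w, w'))` of the exact sequence of the doubled graph. -/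
theorem betti_zero_le_add_betti_one_crossWeights {w w' : I → I → ℝ≥0∞} (hdiag : ∀ i, w i i = 0)
    (hdiag' : ∀ i, w' i i = 0) (hsymm : ∀ i j, w i j = w j i) {α : ℝ≥0∞} (hα : α ≠ ∞) :
    betti (vietorisRips w α) 0 ≤ betti (vietorisRips (fun i j => min (w i j) (w' i j)) α) 0
      + betti (vietorisRips (crossWeights w w') α) 1 := by
  set G := vietorisRips (crossWeights w w') α
  set K := vietorisRips w α with hK
  set L := vietorisRips (fun i j => min (w i j) (w' i j)) α with hL
  have hdiagL : ∀ i, min (w i i) (w' i i) = 0 := fun i => by simp [hdiag]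
  have h1 := betti_zero_add_finrank hdiag α
  have h2 := betti_zero_add_finrank (w := fun i j => min (w i j) (w' i j)) hdiagL α
  rw [cycles_zero_eq (w' := w) hdiagL hdiag α] at h2
  rw [← hK] at h1 h2
  rw [← hL] at h2
  let π := (boundaries K 0).mkQ
  let Ψ : PersistentHomology G G 1 →ₗ[ZMod 2] ((Finset I → ZMod 2) ⧸ boundaries K 0) :=
    ((boundaries G 1).submoduleOf (cycles G 1)).liftQ
      ((π ∘ₗ verticalPart I) ∘ₗ (cycles G 1).subtype) fun c hc => by
        rw [LinearMap.mem_ker, LinearMap.comp_apply, LinearMap.comp_apply,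
          Submodule.mkQ_apply, Submodule.Quotient.mk_eq_zero]
        exact verticalPart_mem_boundaries hdiag hsymm hα hc
  have hrange : (boundaries L 0).map π ≤ LinearMap.range Ψ := by
    rintro _ ⟨c, hc, rfl⟩
    obtain ⟨x, hx, rfl⟩ := boundaries_le_map_verticalPart hdiag hdiag' α hc
    exact ⟨Submodule.Quotient.mk ⟨x, hx⟩, rfl⟩
  have h3 : Module.finrank (ZMod 2) ((boundaries L 0).map π) ≤ betti G 1 :=
    (Submodule.finrank_mono hrange).trans (LinearMap.finrank_range_le Ψ)
  have h4 := LinearMap.finrank_range_add_finrank_ker (π.domRestrict (boundaries L 0))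
  have h5 : Module.finrank (ZMod 2) (LinearMap.ker (π.domRestrict (boundaries L 0)))
      ≤ Module.finrank (ZMod 2) (boundaries K 0) := by
    rw [← Submodule.finrank_map_subtype_eq]
    refine Submodule.finrank_mono ?_
    rintro _ ⟨x, hx, rfl⟩
    rw [SetLike.mem_coe, LinearMap.mem_ker, LinearMap.domRestrict_apply, Submodule.mkQ_apply,
      Submodule.Quotient.mk_eq_zero] at hx
    exact hx
  rw [LinearMap.range_domRestrict] at h4
  omega

end Cross

/-! ### Betti curves and the divergence -/

theorem measurable_betti_vietorisRips {V Ω : Type} [Fintype V] [DecidableEq V]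
    [MeasurableSpace Ω] {m : Ω → V → V → ℝ≥0∞} (hm : ∀ u v, Measurable fun ω => m ω u v)
    {α : Ω → ℝ≥0∞} (hα : Measurable α) (k : ℕ) :
    Measurable fun ω => betti (vietorisRips (m ω) (α ω)) k := by
  -- The complex depends on `ω` only through the finitely many truth values of `m u v ≤ α`.
  have hrel : Measurable fun (ω : Ω) (u v : V) => m ω u v ≤ α ω :=
    measurable_pi_lambda _ fun u => measurable_pi_lambda _ fun v =>
      measurableSet_setOfPred.1 (measurableSet_le (hm u v) hα)
  have hbetti : Measurable fun R : V → V → Prop =>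
      betti {s : Finset V | s.Nonempty ∧ ∀ u ∈ s, ∀ v ∈ s, R u v} k := Measurable.of_discrete
  exact hbetti.comp hrel

theorem edist_natCast_le_add {x y l p p' : ℕ} (hx : x ≤ l + p) (hy : y ≤ l + p') (hlx : l ≤ x)
    (hly : l ≤ y) : edist (x : ℝ) (y : ℝ) ≤ (p : ℝ≥0∞) + p' := by
  have h : ((p : ℝ≥0∞) + p') = ENNReal.ofReal ((p + p' : ℕ) : ℝ) := by
    rw [ENNReal.ofReal_natCast, Nat.cast_add]
  rw [h, edist_dist, Real.dist_eq]
  refine ENNReal.ofReal_le_ofReal (abs_sub_le_iff.2 ⟨?_, ?_⟩)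
  · rw [sub_le_iff_le_add]
    exact_mod_cast (by omega : x ≤ p + p' + y)
  · rw [sub_le_iff_le_add]
    exact_mod_cast (by omega : y ≤ p + p' + x)

/-- The numbers of components of two point clouds, integrated over the finite thresholds, differ
by at most twice their divergence in degree one: both exceed the number of components of the
graph of the pointwise minima by at most the first Betti number of a doubled graph. -/
theorem lintegral_edist_betti_zero_le_RTD {I Y : Type} [Fintype I] [LinearOrder I]
    [PseudoEMetricSpace Y] (X X' : I → Y) :
    ∫⁻ α in Set.Ici (0 : ℝ), edist (betti (vietorisRips (distMatrix X) (ENNReal.ofReal α)) 0 : ℝ)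
      (betti (vietorisRips (distMatrix X') (ENNReal.ofReal α)) 0 : ℝ) ≤ 2 * RTD 1 X X' := by
  set w := distMatrix X
  set w' := distMatrix X'
  have hdiag : ∀ i, w i i = 0 := fun i => edist_self _
  have hdiag' : ∀ i, w' i i = 0 := fun i => edist_self _
  have hsymm : ∀ i j, w i j = w j i := fun i j => edist_comm _ _
  have hsymm' : ∀ i j, w' i j = w' j i := fun i j => edist_comm _ _
  have hmin : (fun i j => min (w' i j) (w i j)) = fun i j => min (w i j) (w' i j) := by
    funext i j
    exact min_comm _ _
  have hpoint : ∀ α : ℝ, edist (betti (vietorisRips w (ENNReal.ofReal α)) 0 : ℝ)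
      (betti (vietorisRips w' (ENNReal.ofReal α)) 0 : ℝ) ≤
      (betti (vietorisRips (crossWeights w w') (ENNReal.ofReal α)) 1 : ℝ≥0∞)
      + betti (vietorisRips (crossWeights w' w) (ENNReal.ofReal α)) 1 := by
    intro α
    have h1 := betti_zero_le_add_betti_one_crossWeights hdiag hdiag' hsymm
      (ENNReal.ofReal_ne_top (r := α))
    have h2 := betti_zero_le_add_betti_one_crossWeights hdiag' hdiag hsymm'
      (ENNReal.ofReal_ne_top (r := α))
    rw [hmin] at h2
    exact edist_natCast_le_add h1 h2
      (betti_zero_anti (fun i => by simp [hdiag]) hdiag (fun i j => min_le_left _ _) _)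
      (betti_zero_anti (fun i => by simp [hdiag]) hdiag' (fun i j => min_le_right _ _) _)
  have hmeas : Measurable fun α : ℝ =>
      (betti (vietorisRips (crossWeights w w') (ENNReal.ofReal α)) 1 : ℝ≥0∞) :=
    measurable_from_top.comp (measurable_betti_vietorisRips (m := fun _ => crossWeights w w')
      (fun _ _ => measurable_const) ENNReal.measurable_ofReal 1)
  calc _ ≤ _ := lintegral_mono hpoint
    _ = _ := lintegral_add_left hmeas _
    _ ≤ RTDOneSided 1 X X' + RTDOneSided 1 X' X :=
        add_le_add (lintegral_betti_le_sum_barcode _ one_ne_zero)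
          (lintegral_betti_le_sum_barcode _ one_ne_zero)
    _ = 2 * RTD 1 X X' := by
        rw [RTD, ENNReal.mul_div_cancel two_ne_zero ENNReal.ofNat_ne_top]

/-- The number of connected components of the Vietoris-Rips complex of a decoded batch at the
threshold `α`, as a degree-zero Betti number. -/
noncomputable def componentCount {n N : ℕ} {Y : Type} [PseudoEMetricSpace Y]
    (f : (Fin n → ℝ) → Y) (z : Fin N → Fin n → ℝ) (α : ℝ) : ℕ :=
  betti (vietorisRips (distMatrix fun j => f (z j)) (ENNReal.ofReal α)) 0

theorem lintegral_edist_componentCount_le_TopDis {n N : ℕ} {Y : Type} [PseudoEMetricSpace Y]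
    (f : (Fin n → ℝ) → Y) (ρ : ℝ) (v : ℝ≥0) (d : Fin n) (C : ℝ) (z : Fin N → Fin n → ℝ)
    (hz : ∀ j, gaussianCDF ρ v (z j d) + C ∈ Set.Ioo (0 : ℝ) 1) :
    ∫⁻ α in Set.Ici (0 : ℝ), edist (componentCount f z α : ℝ)
      (componentCount f (fun j => latentShift ρ v d C (z j)) α : ℝ)
      ≤ 2 * TopDis f ρ v d 1 z C := by
  have hmem : ∀ j, j ∈ validSet ρ v d C z := fun j => by simpa [validSet] using hz j
  refine le_trans (le_of_eq ?_) (lintegral_edist_betti_zero_le_RTD _ _)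
  refine lintegral_congr fun α => ?_
  -- The divergence takes its decidable equality from the linear order of the index type.
  have hre : ∀ [DecidableEq (validSet ρ v d C z)] (X : Fin N → Y),
      betti (vietorisRips (distMatrix fun j : validSet ρ v d C z => X j) (ENNReal.ofReal α)) 0
        = betti (vietorisRips (distMatrix X) (ENNReal.ofReal α)) 0 :=
    @fun _ X => betti_vietorisRips_comp_equiv (Equiv.subtypeUnivEquiv hmem) (distMatrix X) _ 0
  exact (congrArg₂ (fun x y : ℕ => edist (x : ℝ) (y : ℝ)) (hre fun j => f (z j))
    (hre fun j => f (latentShift ρ v d C (z j)))).symm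

/-! ### Gaussian quantiles and a chain of shifts -/

theorem strictMono_gaussianCDF (ρ : ℝ) {v : ℝ≥0} (hv : v ≠ 0) : StrictMono (gaussianCDF ρ v) := by
  intro x y hxy
  have hpos : 0 < gaussianReal ρ v (Set.Ioc x y) := by
    rw [pos_iff_ne_zero]
    intro h
    have := gaussianReal_absolutelyContinuous' ρ hv h
    rw [Real.volume_Ioc, ENNReal.ofReal_eq_zero] at this
    linarith
  rw [← measure_cdf (gaussianReal ρ v), StieltjesFunction.measure_Ioc, ENNReal.ofReal_pos,
    sub_pos] at hpos
  exact hpos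

theorem continuous_gaussianCDF (ρ : ℝ) {v : ℝ≥0} (hv : v ≠ 0) :
    Continuous (gaussianCDF ρ v) := by
  refine continuous_iff_continuousAt.2 fun x => ?_
  refine ((cdf (gaussianReal ρ v)).mono.continuousAt_iff_leftLim_eq_rightLim).2 ?_
  have hx : gaussianReal ρ v {x} = 0 :=
    gaussianReal_absolutelyContinuous ρ hv (measure_singleton x)
  rw [← measure_cdf (gaussianReal ρ v), StieltjesFunction.measure_singleton,
    ENNReal.ofReal_eq_zero, sub_nonpos] at hx
  rw [StieltjesFunction.rightLim_eq]
  exact le_antisymm ((cdf (gaussianReal ρ v)).mono.leftLim_le le_rfl) hx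

theorem gaussianCDF_lt_one (ρ : ℝ) {v : ℝ≥0} (hv : v ≠ 0) (x : ℝ) : gaussianCDF ρ v x < 1 :=
  (strictMono_gaussianCDF ρ hv (lt_add_one x)).trans_le (cdf_le_one _ _)

theorem gaussianQuantile_gaussianCDF (ρ : ℝ) {v : ℝ≥0} (hv : v ≠ 0) (x : ℝ) :
    gaussianQuantile ρ v (gaussianCDF ρ v x) = x := by
  have h : {y | gaussianCDF ρ v x ≤ gaussianCDF ρ v y} = Set.Ici x := by
    ext y
    exact (strictMono_gaussianCDF ρ hv).le_iff_le
  rw [gaussianQuantile, h, csInf_Ici]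

theorem measurable_componentCount {n N : ℕ} {Y Ω : Type} [PseudoEMetricSpace Y]
    [MeasurableSpace Y] [OpensMeasurableSpace Y] [SecondCountableTopology Y] [MeasurableSpace Ω]
    {f : (Fin n → ℝ) → Y} (hf : Measurable f) {z : Ω → Fin N → Fin n → ℝ} (hz : Measurable z)
    {α : Ω → ℝ} (hα : Measurable α) : Measurable fun ω => componentCount f (z ω) (α ω) :=
  measurable_betti_vietorisRips (m := fun ω => distMatrix fun j => f (z ω j)) (fun i j =>
    (hf.comp ((measurable_pi_apply i).comp hz)).edist (hf.comp ((measurable_pi_apply j).comp hz)))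
    (ENNReal.measurable_ofReal.comp hα) 0

theorem measurable_componentCount_right {n N : ℕ} {Y : Type} [PseudoEMetricSpace Y]
    (f : (Fin n → ℝ) → Y) (z : Fin N → Fin n → ℝ) : Measurable (componentCount f z) :=
  measurable_betti_vietorisRips (m := fun _ => distMatrix fun j => f (z j))
    (fun _ _ => measurable_const) ENNReal.measurable_ofReal 0

theorem measurable_edist_natCast {Ω : Type*} [MeasurableSpace Ω] {B B' : Ω → ℕ}
    (hB : Measurable B) (hB' : Measurable B') :
    Measurable fun ω => edist (B ω : ℝ) (B' ω : ℝ) :=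
  (measurable_from_top.comp hB).edist (measurable_from_top.comp hB')

/-- Moving the latent code from `k` up to `k'` is a composition of eight shifts by the same
parameter `(F(k') - F(k)) / 8 ≤ 1 / 8`, so the component counts before and after differ by less
than `8 * 2ε`. -/
theorem lintegral_edist_componentCount_lt {n N : ℕ} {Y : Type} [PseudoEMetricSpace Y]
    (f : (Fin n → ℝ) → Y) (ρ : ℝ) {v : ℝ≥0} (hv : v ≠ 0) (d : Fin n) {ε : ℝ}
    (hTopDis : ∀ (c : ℝ) (z : Fin N → Fin n → ℝ), (∀ j, z j d = c) →
      ∀ a : ℝ, 0 < a → a ≤ 1 / 8 → TopDis f ρ v d 1 z a < ENNReal.ofReal ε)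
    (z : Fin N → Fin n → ℝ) {k k' : ℝ} (hk : k < k') :
    ∫⁻ α in Set.Ici (0 : ℝ), edist (componentCount f (fun j => Function.update (z j) d k) α : ℝ)
      (componentCount f (fun j => Function.update (z j) d k') α : ℝ) < 16 * ENNReal.ofReal ε := by
  set F := gaussianCDF ρ v with hF
  have hmono := strictMono_gaussianCDF ρ hv
  have hnonneg : 0 ≤ F k := cdf_nonneg _ _
  have hlt : F k < F k' := hmono hk
  have hone : F k' < 1 := gaussianCDF_lt_one ρ hv k'
  set a := (F k' - F k) / 8 with ha
  have ha0 : 0 < a := by linarith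
  have hex : ∀ t : ℕ, ∃ x, t ≤ 8 → F x = F k + t * a := by
    intro t
    by_cases ht : t ≤ 8
    · have ht' : (t : ℝ) ≤ 8 := by exact_mod_cast ht
      have hmem : F k + t * a ∈ Set.Icc (F k) (F k') :=
        ⟨by nlinarith [Nat.cast_nonneg (α := ℝ) t], by nlinarith⟩
      obtain ⟨x, -, hx⟩ :=
        intermediate_value_Icc hk.le (continuous_gaussianCDF ρ hv).continuousOn hmem
      exact ⟨x, fun _ => hx⟩
    · exact ⟨0, fun h => absurd h ht⟩
  choose x hx using hex
  have hx0 : x 0 = k := hmono.injective (by simpa using hx 0 (by norm_num))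
  have hx8 : x 8 = k' := hmono.injective ((hx 8 le_rfl).trans (by push_cast; linarith))
  let z' : ℕ → Fin N → Fin n → ℝ := fun t j => Function.update (z j) d (x t)
  have hstep : ∀ t ∈ Finset.range 8, ∫⁻ α in Set.Ici (0 : ℝ), edist (componentCount f (z' t) α : ℝ)
      (componentCount f (z' (t + 1)) α : ℝ) < 2 * ENNReal.ofReal ε := by
    intro t ht
    have ht8 : t + 1 ≤ 8 := Finset.mem_range.1 ht
    have ht8' : (t : ℝ) + 1 ≤ 8 := by exact_mod_cast ht8
    have hnext : F (x t) + a = F (x (t + 1)) := by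
      rw [hx t (by omega), hx (t + 1) ht8]
      push_cast
      ring
    have hz'd : ∀ j, z' t j d = x t := fun j => Function.update_self _ _ _
    have hshift : (fun j => latentShift ρ v d a (z' t j)) = z' (t + 1) := by
      funext j
      rw [latentShift, hz'd, ← hF, hnext, hF, gaussianQuantile_gaussianCDF ρ hv,
        Function.update_idem]
    have hle := lintegral_edist_componentCount_le_TopDis f ρ v d a (z' t) fun j => by
      rw [hz'd, ← hF, hnext]
      refine ⟨?_, gaussianCDF_lt_one ρ hv _⟩
      rw [← hnext]
      exact add_pos_of_nonneg_of_pos (cdf_nonneg _ _) ha0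
    rw [hshift] at hle
    exact hle.trans_lt ((ENNReal.mul_lt_mul_iff_right two_ne_zero ENNReal.ofNat_ne_top).2
      (hTopDis (x t) (z' t) hz'd a ha0 (by linarith)))
  have hends : ∀ α, edist (componentCount f (fun j => Function.update (z j) d k) α : ℝ)
      (componentCount f (fun j => Function.update (z j) d k') α : ℝ) ≤
      ∑ t ∈ Finset.range 8, edist (componentCount f (z' t) α : ℝ)
        (componentCount f (z' (t + 1)) α : ℝ) := by
    intro α
    have h := edist_le_range_sum_edist (fun t => (componentCount f (z' t) α : ℝ)) 8
    simpa only [z', hx0, hx8] using h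
  refine (lintegral_mono hends).trans_lt ?_
  rw [lintegral_finsetSum _ fun t _ => measurable_edist_natCast
    (measurable_componentCount_right f _) (measurable_componentCount_right f _)]
  refine (ENNReal.sum_lt_sum_of_nonempty (by simp) hstep).trans_eq ?_
  rw [Finset.sum_const, Finset.card_range, nsmul_eq_mul, ← mul_assoc]
  norm_num

/-! ### Couplings and relative living times -/

/-- Two integer-valued functions on one measure space couple their laws. -/
theorem wassersteinNat_le_lintegral_edist {Ω : Type*} [MeasurableSpace Ω] (μ : Measure Ω)
    {B B' : Ω → ℕ} (hB : Measurable B) (hB' : Measurable B') :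
    wassersteinNat (fun m => μ (B ⁻¹' {m})) (fun m => μ (B' ⁻¹' {m})) ≤
      ∫⁻ ω, edist (B ω : ℝ) (B' ω : ℝ) ∂μ := by
  have hmarg : ∀ {B : Ω → ℕ}, Measurable B → ∀ A : Set Ω, MeasurableSet A →
      ∑' j, μ (A ∩ B ⁻¹' {j}) = μ A := by
    intro B hB A hA
    rw [← measure_iUnion, ← Set.inter_iUnion, ← Set.preimage_iUnion, Set.iUnion_of_singleton,
      Set.preimage_univ, Set.inter_univ]
    · intro i j hij
      exact ((Set.disjoint_singleton.2 hij).preimage B).mono Set.inter_subset_right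
        Set.inter_subset_right
    · exact fun j => hA.inter (hB (measurableSet_singleton j))
  have hleft : ∀ i, ∑' j, μ (B ⁻¹' {i} ∩ B' ⁻¹' {j}) = μ (B ⁻¹' {i}) := fun i =>
    hmarg hB' _ (hB (measurableSet_singleton i))
  have hright : ∀ j, ∑' i, μ (B ⁻¹' {i} ∩ B' ⁻¹' {j}) = μ (B' ⁻¹' {j}) := fun j => by
    simp only [Set.inter_comm (B ⁻¹' _)]
    exact hmarg hB _ (hB' (measurableSet_singleton j))
  refine (iInf₂_le (fun i j => μ (B ⁻¹' {i} ∩ B' ⁻¹' {j})) ⟨hleft, hright⟩).trans (le_of_eq ?_)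
  have hpair : Measurable fun ω => (B ω, B' ω) := hB.prodMk hB'
  rw [← lintegral_map (f := fun p : ℕ × ℕ => edist (p.1 : ℝ) (p.2 : ℝ)) Measurable.of_discrete
    hpair, lintegral_countable', ENNReal.tsum_prod']
  refine tsum_congr fun i => tsum_congr fun j => ?_
  have hfiber : (fun ω => (B ω, B' ω)) ⁻¹' {(i, j)} = B ⁻¹' {i} ∩ B' ⁻¹' {j} := by
    ext ω
    simp
  rw [Measure.map_apply hpair (measurableSet_singleton _), hfiber, mul_comm]

/-- The uniform law of a threshold on `[0, αmax]`, a probability measure for `αmax > 0`. -/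
noncomputable def thresholdLaw (αmax : ℝ) : Measure ℝ :=
  (ENNReal.ofReal αmax)⁻¹ • volume.restrict (Set.Icc 0 αmax)

instance sFinite_thresholdLaw (αmax : ℝ) : SFinite (thresholdLaw αmax) := by
  unfold thresholdLaw
  infer_instance

theorem sampleRLT_eq_thresholdLaw {n N : ℕ} {Y : Type} [PseudoEMetricSpace Y]
    (f : (Fin n → ℝ) → Y) (αmax : ℝ) (z : Fin N → Fin n → ℝ) (m : ℕ) :
    sampleRLT f αmax z m = thresholdLaw αmax (componentCount f z ⁻¹' {m}) := by
  rw [thresholdLaw, Measure.smul_apply, Measure.restrict_apply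
    (measurable_componentCount_right f z (measurableSet_singleton m)), Set.inter_comm,
    smul_eq_mul, mul_comm, ← div_eq_mul_inv]
  rfl

theorem lintegral_thresholdLaw_lt {αmax ε : ℝ} (hαmax : 0 < αmax) {g : ℝ → ℝ≥0∞}
    (hg : ∫⁻ α in Set.Ici (0 : ℝ), g α < 16 * ENNReal.ofReal ε) :
    ∫⁻ α, g α ∂thresholdLaw αmax < ENNReal.ofReal (16 / αmax * ε) := by
  have h0 : (ENNReal.ofReal αmax)⁻¹ ≠ 0 := by simp
  have htop : (ENNReal.ofReal αmax)⁻¹ ≠ ∞ := by simpa using hαmax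
  have hval : ENNReal.ofReal (16 / αmax * ε) =
      (ENNReal.ofReal αmax)⁻¹ * (16 * ENNReal.ofReal ε) := by
    rw [ENNReal.ofReal_mul (by positivity), div_eq_inv_mul, ENNReal.ofReal_mul (by positivity),
      ENNReal.ofReal_inv_of_pos hαmax, ENNReal.ofReal_ofNat, mul_assoc]
  rw [thresholdLaw, lintegral_smul_measure, smul_eq_mul, hval]
  exact (ENNReal.mul_lt_mul_iff_right h0 htop).2
    ((lintegral_mono_set Set.Icc_subset_Ici_self).trans_lt hg)

theorem measurable_update_batch {n N : ℕ} (d : Fin n) (k : ℝ) :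
    Measurable fun (z : Fin N → Fin n → ℝ) (j : Fin N) => Function.update (z j) d k := by
  fun_prop

/-- The mean relative living times are the law of the component count of a random batch at an
independent uniform threshold. -/
theorem submanifoldRLT_eq_prod {n N : ℕ} {Y : Type} [PseudoEMetricSpace Y] [MeasurableSpace Y]
    [OpensMeasurableSpace Y] [SecondCountableTopology Y] {f : (Fin n → ℝ) → Y} (hf : Measurable f)
    (q : Fin n → Measure ℝ) [∀ i, IsProbabilityMeasure (q i)] (αmax : ℝ) (d : Fin n) (k : ℝ)
    (m : ℕ) :
    submanifoldRLT f q N αmax d k m =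
      ((Measure.pi fun _ : Fin N => Measure.pi q).prod (thresholdLaw αmax))
        ((fun p => componentCount f (fun j => Function.update (p.1 j) d k) p.2) ⁻¹' {m}) := by
  have hupd : Measurable fun z : Fin n → ℝ => Function.update z d k := by fun_prop
  have : IsProbabilityMeasure ((Measure.pi q).map fun z => Function.update z d k) :=
    Measure.isProbabilityMeasure_map hupd.aemeasurable
  have hlaw : (Measure.pi fun _ : Fin N => conditionedLatentLaw q d k) =
      (Measure.pi fun _ : Fin N => Measure.pi q).map
        fun z j => Function.update (z j) d k :=
    (Measure.pi_map_pi fun _ => hupd.aemeasurable).symm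
  have hcount : Measurable fun p : (Fin N → Fin n → ℝ) × ℝ => componentCount f p.1 p.2 :=
    measurable_componentCount hf measurable_fst measurable_snd
  have hmeas : Measurable fun z : Fin N → Fin n → ℝ => sampleRLT f αmax z m := by
    simp only [sampleRLT_eq_thresholdLaw]
    exact measurable_measure_prodMk_left (hcount (measurableSet_singleton m))
  rw [submanifoldRLT, hlaw, lintegral_map hmeas (measurable_update_batch d k),
    Measure.prod_apply]
  · simp only [sampleRLT_eq_thresholdLaw]
    rfl
  · exact (measurable_componentCount hf ((measurable_update_batch d k).comp measurable_fst)
      measurable_snd) (measurableSet_singleton m)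

theorem proposition3 {n D N : ℕ}
    (f : (Fin n → ℝ) → EuclideanSpace ℝ (Fin D)) (hf : Measurable f)
    (q : Fin n → Measure ℝ) [∀ i, IsProbabilityMeasure (q i)]
    (ρ : ℝ) (v : ℝ≥0) (hv : v ≠ 0) (d : Fin n)
    (αmax : ℝ) (hαmax : 0 < αmax) (ε : ℝ)
    (hTopDis : ∀ (c : ℝ) (z : Fin N → Fin n → ℝ), (∀ j, z j d = c) →
      ∀ a : ℝ, 0 < a → a ≤ 1 / 8 → ∀ i : ℕ, i = 0 ∨ i = 1 →
        TopDis f ρ v d i z a < ENNReal.ofReal ε)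
    (k k' : ℝ) :
    (∀ z : Fin N → Fin n → ℝ, (∀ j, z j d = k) →
      wassersteinNat (sampleRLT f αmax z)
        (sampleRLT f αmax fun j => Function.update (z j) d k')
          < ENNReal.ofReal (16 / αmax * ε)) ∧
    wassersteinNat (submanifoldRLT f q N αmax d k) (submanifoldRLT f q N αmax d k')
      < ENNReal.ofReal (16 / αmax * ε) := by
  have hε : 0 < ENNReal.ofReal ε :=
    zero_le.trans_lt (hTopDis 0 0 (fun _ => rfl) (1 / 8) (by norm_num) le_rfl 1 (Or.inr rfl))
  have hdist : ∀ z : Fin N → Fin n → ℝ, ∫⁻ α, edist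
      (componentCount f (fun j => Function.update (z j) d k) α : ℝ)
      (componentCount f (fun j => Function.update (z j) d k') α : ℝ) ∂thresholdLaw αmax
        < ENNReal.ofReal (16 / αmax * ε) := by
    intro z
    refine lintegral_thresholdLaw_lt hαmax ?_
    have hup : ∀ k k' : ℝ, k < k' → _ := fun k k' h =>
      lintegral_edist_componentCount_lt f ρ hv d
        (fun c z hz a h0 h1 => hTopDis c z hz a h0 h1 1 (Or.inr rfl)) z (k := k) (k' := k') h
    rcases lt_trichotomy k k' with h | rfl | h
    · exact hup k k' h
    · simpa using hε
    · simpa only [edist_comm] using hup k' k h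
  refine ⟨fun z hz => ?_, ?_⟩
  · have hzk : (fun j => Function.update (z j) d k) = z := by
      funext j
      rw [← hz j, Function.update_eq_self]
    have h := hdist z
    rw [hzk] at h
    refine lt_of_le_of_lt ?_ h
    rw [funext (sampleRLT_eq_thresholdLaw f αmax z), funext (sampleRLT_eq_thresholdLaw f αmax _)]
    exact wassersteinNat_le_lintegral_edist _ (measurable_componentCount_right f _)
      (measurable_componentCount_right f _)
  · have hcount : ∀ k : ℝ, Measurable fun p : (Fin N → Fin n → ℝ) × ℝ =>
        componentCount f (fun j => Function.update (p.1 j) d k) p.2 := fun k =>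
      measurable_componentCount hf ((measurable_update_batch d k).comp measurable_fst)
        measurable_snd
    have hW := wassersteinNat_le_lintegral_edist
      ((Measure.pi fun _ : Fin N => Measure.pi q).prod (thresholdLaw αmax)) (hcount k) (hcount k')
    simp only [← submanifoldRLT_eq_prod hf] at hW
    refine hW.trans_lt ?_
    rw [lintegral_prod _ (measurable_edist_natCast (hcount k) (hcount k')).aemeasurable]
    have hconst : ∫⁻ _ : Fin N → Fin n → ℝ, ENNReal.ofReal (16 / αmax * ε)
        ∂(Measure.pi fun _ : Fin N => Measure.pi q) = ENNReal.ofReal (16 / αmax * ε) := by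
      simp
    rw [← hconst]
    refine lintegral_strict_mono (IsProbabilityMeasure.ne_zero _) aemeasurable_const ?_
      (Filter.Eventually.of_forall hdist)
    refine ((lintegral_mono fun z => (hdist z).le).trans_lt ?_).ne
    rw [hconst]
    exact ENNReal.ofReal_lt_top
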